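/- Consider a wireless network whose transmitters form a homogeneous Poisson point process of density $\lambda>0$ in the plane. Each transmitter has a receiver at distance $d>0$, path loss has exponent $\alpha>2$, fading is independent Rayleigh, noise is neglected, and a transmission succeeds if the signal to interference ratio exceeds $\theta>0$; the rate is $R=\log_2(1+\theta)$. Each transmitter has a battery of finite capacity $B\ge 1$. In each slot a unit of energy arrives with probability $p\in(0,1]$, and a transmitter with access probability $q\in[0,1]$ transmits with probability $q$, using one unit of energy, if its battery is not empty. Its energy is thus a Markov chain on $\{0,\dots,B\}$ with transitions $0\to1$ with probability $p$, $i\to i+1$ with probability $p(1-q)$ for $1\le i<B$, $i\to i-1$ with probability $q(1-p)$ for $1\le i\le B$, and $i\to i$ otherwise. Let $r_B(q)$ be the stationary probability that the battery is not empty, $f_B(q)=q\,r_B(q)$ for $q\in[0,1]$, and $\lambda_{\max}=\bigl(d^2\theta^{2/\alpha}\kappa(\alpha)\bigr)^{-1}$ with $\kappa(\alpha)=\frac{2\pi^2}{\alpha\sin(2\pi/\alpha)}$. In the throughput game, a transmitter that uses $q$ while all others use $\tilde q$ gets the throughput $\mathsf{TH}(q,\tilde q)=f_B(q)\,P_{\mathrm{suc}}(\tilde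 q)\,R$, where $P_{\mathrm{suc}}(\tilde q)$ is the success probability at a typical receiver when the interferers use $\tilde q$ and their batteries are in steady state. A symmetric Nash equilibrium is a $q^*\in[0,1]$ with $\mathsf{TH}(q^*,q^*)=\max_{q\in[0,1]}\mathsf{TH}(q,q^*)$. The price of anarchy is the ratio of the maximum over $q\in[0,1]$ of the transmission capacity $C(q)=\lambda\,\mathsf{TH}(q,q)$ to the least value of $C$ at a symmetric Nash equilibrium. If the equation $f_B(y)=\lambda_{\max}/\lambda$ has no solution $y\in[0,1]$ (its solution exceeds $1$), then the price of anarchy is $1$. Otherwise, every $q^\star\in[0,1]$ with $f_B(q^\star)=\lambda_{\max}/\lambda$ maximizes $C$ over $[0,1]$, and the price of anarchy is $$\frac{\lambda f_B(q^\star)\exp\left(-\frac{\lambda f_B(q^\star)}{\lambda_{\max}}\right)}{\lambda p\exp\left(-\frac{\lambda p}{\lambda_{\max}}\right)}.$$ In both cases the maximum and the least equilibrium value exist, and the latter is positive. -/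

import Mathlib

open MeasureTheory ProbabilityTheory

universe u

noncomputable section

/-! ### The energy queue of one transmitter -/

/-- One-step transition probabilities of the energy queue with battery capacity `B`, energy arrival
probability `p` and access probability `q`, on the states `0, 1, …, B`. A transmitter with no energy
cannot transmit, and a unit of energy that arrives at a full battery that is not used is lost. -/
def queueStep (B : ℕ) (p q : ℝ) (i j : Fin (B + 1)) : ℝ :=
  if (i : ℕ) = 0 then
    if (j : ℕ) = 1 then p else if (j : ℕ) = 0 then 1 - p else 0
  else if (j : ℕ) = i + 1 then p * (1 - q)
  else if (j : ℕ) + 1 = i then q * (1 - p)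
  else if j = i then
    if (i : ℕ) = B then 1 - q * (1 - p) else 1 - p * (1 - q) - q * (1 - p)
  else 0

/-- `π` is a stationary distribution of the energy queue. -/
def IsStationaryLaw (B : ℕ) (p q : ℝ) (π : Measure (Fin (B + 1))) : Prop :=
  IsProbabilityMeasure π ∧ ∀ j, π.real {j} = ∑ i, π.real {i} * queueStep B p q i j

open Classical in
/-- `r_B`: the stationary probability that the battery is not empty. (A stationary distribution
exists for all `p, q ∈ [0, 1]`, `1 ≤ B`; for `0 < p` this value does not depend on which one is
chosen.) -/
def availProb (B : ℕ) (p q : ℝ) : ℝ :=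
  if h : ∃ π : Measure (Fin (B + 1)), IsStationaryLaw B p q π then h.choose.real {0}ᶜ else 0

/-- `f_B(q) = q r_B`, the probability that a transmitter with access probability `q` transmits. -/
def activeProb (B : ℕ) (p q : ℝ) : ℝ := q * availProb B p q

/-! ### The network as seen by a typical receiver -/

/-- The plane. -/
abbrev Plane : Type := EuclideanSpace ℝ (Fin 2)

/-- The number of points of the random sequence `X` in the set `A`. -/
def pointCount {Ω : Type*} (X : ℕ → Ω → Plane) (A : Set Plane) (ω : Ω) : ℕ∞ :=
  Set.encard {s | X s ω ∈ A}

/-- The points `X 0, X 1, …` form a homogeneous Poisson point process of density `lam` on the plane: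
counts are Poisson distributed, and counts in disjoint sets are independent. -/
structure IsPoissonProcess {Ω : Type*} [MeasurableSpace Ω] (μ : Measure Ω) (lam : ℝ)
    (X : ℕ → Ω → Plane) : Prop where
  measurable : ∀ s, Measurable (X s)
  count_law : ∀ A : Set Plane, MeasurableSet A → volume A ≠ ⊤ →
    μ.map (pointCount X A) =
      (poissonMeasure (lam * (volume A).toReal).toNNReal).map (Nat.cast : ℕ → ℕ∞)
  count_indep : ∀ (n : ℕ) (A : Fin n → Set Plane), (∀ i, MeasurableSet (A i)) →
    (∀ i, volume (A i) ≠ ⊤) → Pairwise (fun i j => Disjoint (A i) (A j)) →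
    iIndepFun (fun i => pointCount X (A i)) μ

/-- The law of a coin that shows `true` with probability `q`. -/
def coinLaw (q : ℝ) : Measure Bool :=
  ENNReal.ofReal q • Measure.dirac true + ENNReal.ofReal (1 - q) • Measure.dirac false

/-- One time slot, in steady state, of the network in which all interfering transmitters use the
access probability `q`, as seen by the receiver of a typical pair, which is placed at the origin.
By the usual convention for a typical pair, the other transmitters form a homogeneous Poisson
process of density `lam`. The power gains `|h|²` under Rayleigh fading are exponential, with a
common parameter `ν`. -/
structure Network (B : ℕ) (p q lam ν : ℝ) where
  /-- the sample space -/
  Ω : Type u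
  [mΩ : MeasurableSpace Ω]
  /-- the probability -/
  μ : Measure Ω
  [prob : IsProbabilityMeasure μ]
  /-- location of interfering transmitter `s` -/
  pos : ℕ → Ω → Plane
  /-- energy in the battery of interfering transmitter `s` -/
  energy : ℕ → Ω → Fin (B + 1)
  /-- whether interfering transmitter `s` wants to transmit -/
  coin : ℕ → Ω → Bool
  /-- power gain from interfering transmitter `s` to the typical receiver -/
  gain : ℕ → Ω → ℝ
  /-- power gain from the typical transmitter to its receiver -/
  ownGain : Ω → ℝ
  /-- the stationary law of the batteries -/
  energyLaw : Measure (Fin (B + 1))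
  stationary : IsStationaryLaw B p q energyLaw
  poisson : IsPoissonProcess μ lam pos
  measurable_energy : ∀ s, Measurable (energy s)
  measurable_coin : ∀ s, Measurable (coin s)
  measurable_gain : ∀ s, Measurable (gain s)
  measurable_ownGain : Measurable ownGain
  marks_law : ∀ s, μ.map (fun ω => (energy s ω, coin s ω, gain s ω)) =
    energyLaw.prod ((coinLaw q).prod (expMeasure ν))
  marks_indep : iIndepFun (fun s ω => (energy s ω, coin s ω, gain s ω)) μ
  ownGain_law : μ.map ownGain = expMeasure ν
  pos_indep_marks : IndepFun (fun ω s => pos s ω)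
    (fun ω s => (energy s ω, coin s ω, gain s ω)) μ
  ownGain_indep : IndepFun ownGain
    (fun ω => ((fun s => pos s ω), fun s => (energy s ω, coin s ω, gain s ω))) μ

namespace Network

variable {B : ℕ} {p q lam ν : ℝ}

/-- Interfering transmitter `s` transmits: it has energy and it wants to transmit. -/
def Transmits (N : Network.{u} B p q lam ν) (s : ℕ) (ω : N.Ω) : Prop :=
  N.energy s ω ≠ 0 ∧ N.coin s ω = true

open Classical in
/-- The interference at the typical receiver, with path-loss exponent `α`. -/
def interference (N : Network.{u} B p q lam ν) (α : ℝ) (ω : N.Ω) : ENNReal :=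
  ∑' s, if N.Transmits s ω then ‖N.pos s ω‖ₑ ^ (-α) * ENNReal.ofReal (N.gain s ω) else 0

/-- The signal to interference ratio of the typical pair, whose nodes are at distance `d`
(infinite if there is no interference). -/
def SIR (N : Network.{u} B p q lam ν) (α d : ℝ) (ω : N.Ω) : ENNReal :=
  ENNReal.ofReal (d ^ (-α) * N.ownGain ω) / N.interference α ω

/-- The success probability `P(SIR > θ)`. -/
def successProb (N : Network.{u} B p q lam ν) (α d θ : ℝ) : ℝ :=
  haveI := N.mΩ
  N.μ.real {ω | ENNReal.ofReal θ < N.SIR α d ω}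

end Network

/-! ### The throughput game -/

/-- Access probabilities. -/
abbrev Access : Type := Set.Icc (0 : ℝ) 1

/-- The throughput `TH(q, q')` of a transmitter that uses the access probability `q` while all the
others use `q'`; the rate is `log (1 + θ)` bits. -/
def throughput {B : ℕ} {p lam ν : ℝ} (net : ∀ q : Access, Network.{u} B p q lam ν)
    (α d θ : ℝ) (q q' : Access) : ℝ :=
  activeProb B p q * (net q').successProb α d θ * Real.logb 2 (1 + θ)

/-- The transmission capacity when all transmitters use `q`. -/
def capacity {B : ℕ} {p lam ν : ℝ} (net : ∀ q : Access, Network.{u} B p q lam ν)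
    (α d θ : ℝ) (q : Access) : ℝ :=
  lam * throughput net α d θ q q

/-- Symmetric Nash equilibrium of a symmetric game, where `TH q q'` is the payoff of a player who
plays `q` while all the others play `q'`. -/
def IsSNE {S : Type*} (TH : S → S → ℝ) (q : S) : Prop :=
  ∀ q' : S, TH q' q ≤ TH q q

/-- `ρ` is the price of anarchy: the utility `C` at a global optimum over the utility at a worst
symmetric equilibrium; both are attained, and the latter is positive. -/
def IsPriceOfAnarchy {S : Type*} (TH : S → S → ℝ) (C : S → ℝ) (ρ : ℝ) : Prop :=
  ∃ best worst : ℝ, IsGreatest (Set.range C) best ∧ IsLeast (C '' {q | IsSNE TH q}) worst ∧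
    0 < worst ∧ ρ = best / worst

/-- `κ(α)`. -/
def kappa (α : ℝ) : ℝ := 2 * Real.pi ^ 2 / (α * Real.sin (2 * Real.pi / α))

/-- `λ_max`. -/
def lamMax (α d θ : ℝ) : ℝ := 1 / (d ^ 2 * θ ^ (2 / α) * kappa α)

end

/-! In the stationary energy queue the energy that arrives is either spent or lost at a full
battery, so that `f_B(q) = p - p (1 - q) π {B} ≤ p`, with equality at `q = 1`. The interferers that
transmit are an independent thinning of the Poisson process, hence the Laplace functional of the
marked process, with Rayleigh fading, gives the success probability `exp (-λ f_B(q) / λ_max)`, which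
is positive. So a best response maximizes `f_B`, an access probability is a symmetric equilibrium if
and only if `f_B(q) = p`, and all equilibria have the same capacity. The capacity is proportional to
`x exp (-x / λ_max)` at `x = λ f_B(q)`, which increases up to its maximum at `x = λ_max`; by
continuity of `f_B`, this point is attained if and only if `λ_max ≤ λ p`. -/

section EnergyQueue

open Finset

/-- The law `π` of an energy level, as a function on `ℕ` that vanishes above the capacity `B`. -/
noncomputable def levelProb {B : ℕ} (π : Measure (Fin (B + 1))) (k : ℕ) : ℝ :=
  π.real {i | (i : ℕ) = k}

/-- The probability that the energy queue moves up from a level `k` below the capacity. The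
probability that it moves down from any level `k + 1` is `q * (1 - p)`. -/
def upProb (p q : ℝ) (k : ℕ) : ℝ := if k = 0 then p else p * (1 - q)

/-- The unnormalised stationary weights `u₀ ⋯ uₖ₋₁ dₖ ⋯ d_{B-1}` of a birth–death chain on
`{0, …, B}` that moves from `k` to `k + 1` with probability `u k` and from `k + 1` to `k` with
probability `d k`. They are not divided by `d₀ ⋯ dₖ₋₁`, so that zero rates are allowed. -/
def birthDeathWeight (u d : ℕ → ℝ) (B k : ℕ) : ℝ := (∏ j ∈ range k, u j) * ∏ j ∈ Ico k B, d j

/-- The unnormalised stationary weights of the energy queue. -/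
def queueWeight (B : ℕ) (p q : ℝ) : ℕ → ℝ :=
  birthDeathWeight (upProb p q) (fun _ => q * (1 - p)) B

lemma levelProb_coe {B : ℕ} (π : Measure (Fin (B + 1))) (i : Fin (B + 1)) :
    levelProb π i = π.real {i} := by
  simp only [levelProb, ← Fin.ext_iff, Set.ofPred_eq_eq_singleton]

lemma levelProb_nonneg {B : ℕ} (π : Measure (Fin (B + 1))) (k : ℕ) : 0 ≤ levelProb π k :=
  measureReal_nonneg

lemma sum_levelProb {B : ℕ} (π : Measure (Fin (B + 1))) [IsProbabilityMeasure π] :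
    ∑ k ∈ range (B + 1), levelProb π k = 1 := by
  simp only [← Fin.sum_univ_eq_sum_range (levelProb π), levelProb_coe, sum_measureReal_singleton,
    coe_univ, probReal_univ]

lemma birthDeathWeight_balance (u d : ℕ → ℝ) {B k : ℕ} (hk : k < B) :
    birthDeathWeight u d B k * u k = birthDeathWeight u d B (k + 1) * d k := by
  rw [birthDeathWeight, birthDeathWeight, prod_eq_prod_Ico_succ_bot hk, prod_range_succ]
  ring

lemma mul_prod_eq_of_balance {u d x : ℕ → ℝ} {B : ℕ}
    (hx : ∀ k < B, x k * u k = x (k + 1) * d k) {k : ℕ} (hk : k ≤ B) :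
    x 0 * ∏ j ∈ range k, u j = x k * ∏ j ∈ range k, d j := by
  induction k with
  | zero => simp
  | succ k ih =>
    rw [prod_range_succ, prod_range_succ, ← mul_assoc, ih (by omega)]
    linear_combination (∏ j ∈ range k, d j) * hx k (by omega)

lemma zero_mul_sum_birthDeathWeight_of_balance {u d x : ℕ → ℝ} {B : ℕ}
    (hx : ∀ k < B, x k * u k = x (k + 1) * d k) :
    x 0 * ∑ k ∈ range (B + 1), birthDeathWeight u d B k =
      (∑ k ∈ range (B + 1), x k) * ∏ j ∈ range B, d j := by
  rw [mul_sum, sum_mul]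
  refine sum_congr rfl fun k hk => ?_
  have hkB : k ≤ B := mem_range_succ_iff.1 hk
  rw [birthDeathWeight, ← mul_assoc, mul_prod_eq_of_balance hx hkB, mul_assoc,
    prod_range_mul_prod_Ico d hkB]

lemma queueStep_eq {B : ℕ} (hB : 1 ≤ B) (p q : ℝ) (i j : Fin (B + 1)) :
    queueStep B p q i j = (if (i : ℕ) = j then 1 else 0) +
      (if (i : ℕ) < B then
        upProb p q i * ((if (i : ℕ) + 1 = j then 1 else 0) - if (i : ℕ) = j then 1 else 0) else 0) +
      (if (i : ℕ) = 0 then 0 else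
        q * (1 - p) * ((if (i : ℕ) = j + 1 then 1 else 0) - if (i : ℕ) = j then 1 else 0)) := by
  have hi := i.2
  have hj := j.2
  simp only [queueStep, upProb, Fin.ext_iff]
  split_ifs <;> first | omega | ring

lemma sum_mul_queueStep {B : ℕ} (hB : 1 ≤ B) (p q : ℝ) (x : ℕ → ℝ) (j : Fin (B + 1)) :
    ∑ i : Fin (B + 1), x i * queueStep B p q i j = x j +
      ∑ k ∈ range B, (x k * upProb p q k - x (k + 1) * (q * (1 - p))) *
        ((if k + 1 = (j : ℕ) then 1 else 0) - if k = (j : ℕ) then 1 else 0) := by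
  simp_rw [queueStep_eq hB, mul_add, sum_add_distrib, sub_mul, sum_sub_distrib]
  have hstay : ∑ i : Fin (B + 1), x i * (if (i : ℕ) = j then 1 else 0) = x j := by
    simp [← Fin.ext_iff]
  have hup : ∑ i : Fin (B + 1), x i * (if (i : ℕ) < B then upProb p q i *
      ((if (i : ℕ) + 1 = j then 1 else 0) - if (i : ℕ) = j then 1 else 0) else 0) =
      ∑ k ∈ range B, x k * upProb p q k *
        ((if k + 1 = (j : ℕ) then 1 else 0) - if k = (j : ℕ) then 1 else 0) := by
    rw [Fin.sum_univ_castSucc]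
    simp [← Fin.sum_univ_eq_sum_range, mul_assoc]
  have hdown : ∑ i : Fin (B + 1), x i * (if (i : ℕ) = 0 then 0 else q * (1 - p) *
      ((if (i : ℕ) = j + 1 then 1 else 0) - if (i : ℕ) = j then 1 else 0)) =
      -∑ k ∈ range B, x (k + 1) * (q * (1 - p)) *
        ((if k + 1 = (j : ℕ) then 1 else 0) - if k = (j : ℕ) then 1 else 0) := by
    rw [Fin.sum_univ_succ, ← sum_neg_distrib]
    simp only [Fin.val_zero, if_true, mul_zero, zero_add, Fin.val_succ, Nat.add_right_cancel_iff,
      Nat.succ_ne_zero, if_false, ← Fin.sum_univ_eq_sum_range]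
    exact sum_congr rfl fun k _ => by ring
  rw [hstay, hup, hdown]
  ring

lemma forall_sum_flow_eq_zero_iff {B : ℕ} {c : ℕ → ℝ} :
    (∀ j : Fin (B + 1), ∑ k ∈ range B,
      c k * ((if k + 1 = (j : ℕ) then 1 else 0) - if k = (j : ℕ) then 1 else 0) = 0) ↔
      ∀ k < B, c k = 0 := by
  refine ⟨fun h k hk => ?_, fun h j => sum_eq_zero fun k hk => ?_⟩
  · induction k with
    | zero => simpa [mul_sub, hk] using h ⟨0, B.succ_pos⟩
    | succ k ih => simpa [mul_sub, hk, ih (by omega)] using h ⟨k + 1, by omega⟩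
  · rw [h k (mem_range.1 hk), zero_mul]

lemma isStationaryLaw_iff_balance {B : ℕ} (hB : 1 ≤ B) {p q : ℝ} {π : Measure (Fin (B + 1))} :
    IsStationaryLaw B p q π ↔ IsProbabilityMeasure π ∧
      ∀ k < B, levelProb π k * upProb p q k = levelProb π (k + 1) * (q * (1 - p)) := by
  refine and_congr_right fun _ => ?_
  simp_rw [← levelProb_coe, sum_mul_queueStep hB, left_eq_add, forall_sum_flow_eq_zero_iff,
    sub_eq_zero]

lemma levelProb_sum_dirac {B : ℕ} {x : ℕ → ℝ} (hx : ∀ k, 0 ≤ x k) {k : ℕ} (hk : k ≤ B) :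
    levelProb (∑ i : Fin (B + 1), ENNReal.ofReal (x i) • Measure.dirac i) k = x k := by
  rw [← Fin.val_mk (Nat.lt_succ_of_le hk), levelProb_coe]
  simp [measureReal_def, Set.indicator_apply, hx]

lemma exists_isStationaryLaw_of_balance {B : ℕ} (hB : 1 ≤ B) {p q : ℝ} {x : ℕ → ℝ}
    (hx : ∀ k, 0 ≤ x k) (hpos : 0 < ∑ k ∈ range (B + 1), x k)
    (hbal : ∀ k < B, x k * upProb p q k = x (k + 1) * (q * (1 - p))) :
    ∃ π, IsStationaryLaw B p q π := by
  set S := ∑ k ∈ range (B + 1), x k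
  have hnonneg : ∀ k, 0 ≤ x k / S := fun k => div_nonneg (hx k) hpos.le
  refine ⟨∑ i : Fin (B + 1), ENNReal.ofReal (x i / S) • Measure.dirac i,
    (isStationaryLaw_iff_balance hB).2 ⟨⟨?_⟩, fun k hk => ?_⟩⟩
  · simp only [Measure.finsetSum_apply, Measure.smul_apply, measure_univ, smul_eq_mul, mul_one]
    rw [← ENNReal.ofReal_sum_of_nonneg fun (i : Fin (B + 1)) _ => hnonneg i,
      Fin.sum_univ_eq_sum_range (fun k => x k / S), ← sum_div, div_self hpos.ne',
      ENNReal.ofReal_one]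
  · rw [levelProb_sum_dirac hnonneg hk.le, levelProb_sum_dirac hnonneg hk]
    linear_combination hbal k hk / S

lemma upProb_nonneg {p q : ℝ} (hp : 0 ≤ p) (hq : q ≤ 1) (k : ℕ) : 0 ≤ upProb p q k := by
  unfold upProb
  split_ifs
  exacts [hp, mul_nonneg hp (sub_nonneg.2 hq)]

lemma queueWeight_nonneg (B : ℕ) {p q : ℝ} (hp : p ∈ Set.Icc 0 1) (hq : q ∈ Set.Icc 0 1) (k : ℕ) :
    0 ≤ queueWeight B p q k :=
  mul_nonneg (prod_nonneg fun j _ => upProb_nonneg hp.1 hq.2 j)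
    (prod_nonneg fun _ _ => mul_nonneg hq.1 (sub_nonneg.2 hp.2))

lemma sum_queueWeight_pos (B : ℕ) {p q : ℝ} (hp : p ∈ Set.Ioo 0 1) (hq : q ∈ Set.Icc 0 1) :
    0 < ∑ k ∈ range (B + 1), queueWeight B p q k := by
  refine sum_pos' (fun k _ => queueWeight_nonneg B (Set.Ioo_subset_Icc_self hp) hq k) ?_
  rcases hq.1.eq_or_lt with rfl | hq0
  · refine ⟨B, self_mem_range_succ B, ?_⟩
    simp [queueWeight, birthDeathWeight, upProb, hp.1]
  · refine ⟨0, by simp, ?_⟩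
    have hdown : 0 < q * (1 - p) := mul_pos hq0 (sub_pos.2 hp.2)
    simpa [queueWeight, birthDeathWeight] using pow_pos hdown B

lemma exists_isStationaryLaw {B : ℕ} (hB : 1 ≤ B) {p q : ℝ} (hp : p ∈ Set.Ioc 0 1)
    (hq : q ∈ Set.Icc 0 1) : ∃ π, IsStationaryLaw B p q π := by
  rcases hp.2.eq_or_lt with rfl | hp1
  · refine exists_isStationaryLaw_of_balance hB (x := fun k => if k = B then 1 else 0)
      (fun k => by positivity) (by simp) fun k hk => ?_
    simp [hk.ne]
  · exact exists_isStationaryLaw_of_balance hB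
      (queueWeight_nonneg B (Set.Ioc_subset_Icc_self hp) hq)
      (sum_queueWeight_pos B ⟨hp.1, hp1⟩ hq) fun k hk => birthDeathWeight_balance _ _ hk

variable {B : ℕ} {p q : ℝ} {π : Measure (Fin (B + 1))}

lemma IsStationaryLaw.levelProb_zero_eq (h : IsStationaryLaw B p q π) (hB : 1 ≤ B)
    (hp : p ∈ Set.Ioc 0 1) (hq : q ∈ Set.Icc 0 1) :
    levelProb π 0 = (q * (1 - p)) ^ B / ∑ k ∈ range (B + 1), queueWeight B p q k := by
  obtain ⟨_, hbal⟩ := (isStationaryLaw_iff_balance hB).1 h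
  rcases hp.2.eq_or_lt with rfl | hp1
  · simpa [upProb, Nat.one_le_iff_ne_zero.1 hB] using hbal 0 hB
  · rw [eq_div_iff (sum_queueWeight_pos B ⟨hp.1, hp1⟩ hq).ne', queueWeight,
      zero_mul_sum_birthDeathWeight_of_balance hbal, sum_levelProb, one_mul, prod_const, card_range]

lemma IsStationaryLaw.real_compl_zero (h : IsStationaryLaw B p q π) :
    π.real {0}ᶜ = 1 - levelProb π 0 := by
  have := h.1
  rw [probReal_compl_eq_one_sub (MeasurableSet.singleton _), ← levelProb_coe, Fin.val_zero]

lemma availProb_eq_one_sub_div (hB : 1 ≤ B) (hp : p ∈ Set.Ioc 0 1) (hq : q ∈ Set.Icc 0 1) :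
    availProb B p q =
      1 - (q * (1 - p)) ^ B / ∑ k ∈ range (B + 1), queueWeight B p q k := by
  have h := exists_isStationaryLaw hB hp hq
  rw [availProb, dif_pos h, h.choose_spec.real_compl_zero, h.choose_spec.levelProb_zero_eq hB hp hq]

lemma IsStationaryLaw.availProb_eq (h : IsStationaryLaw B p q π) (hB : 1 ≤ B) (hp : p ∈ Set.Ioc 0 1)
    (hq : q ∈ Set.Icc 0 1) : availProb B p q = π.real {0}ᶜ := by
  rw [availProb_eq_one_sub_div hB hp hq, h.real_compl_zero, h.levelProb_zero_eq hB hp hq]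

lemma IsStationaryLaw.activeProb_eq (h : IsStationaryLaw B p q π) (hB : 1 ≤ B)
    (hp : p ∈ Set.Ioc 0 1) (hq : q ∈ Set.Icc 0 1) :
    activeProb B p q = p - p * (1 - q) * levelProb π B := by
  obtain ⟨_, hbal⟩ := (isStationaryLaw_iff_balance hB).1 h
  have hflow : ∑ k ∈ range B, levelProb π k * upProb p q k =
      ∑ k ∈ range B, levelProb π (k + 1) * (q * (1 - p)) :=
    sum_congr rfl fun k hk => hbal k (mem_range.1 hk)
  have hup (k : ℕ) : upProb p q k = p * (1 - q) + if k = 0 then p * q else 0 := by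
    unfold upProb
    split_ifs <;> ring
  have hempty : ∑ k ∈ range B, levelProb π k * (if k = 0 then p * q else 0) =
      levelProb π 0 * (p * q) := by
    simp [Nat.one_le_iff_ne_zero.1 hB]
  have hbelow : ∑ k ∈ range B, levelProb π k = 1 - levelProb π B := by
    rw [← sum_levelProb π, sum_range_succ, add_sub_cancel_right]
  have habove : ∑ k ∈ range B, levelProb π (k + 1) = 1 - levelProb π 0 := by
    rw [← sum_levelProb π, sum_range_succ', add_sub_cancel_right]
  simp_rw [hup, mul_add, sum_add_distrib] at hflow
  rw [hempty, ← sum_mul, ← sum_mul, hbelow, habove] at hflow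
  rw [activeProb, h.availProb_eq hB hp hq, h.real_compl_zero]
  linear_combination -hflow

lemma activeProb_le (hB : 1 ≤ B) (hp : p ∈ Set.Ioc 0 1) (hq : q ∈ Set.Icc 0 1) :
    activeProb B p q ≤ p := by
  obtain ⟨π, h⟩ := exists_isStationaryLaw hB hp hq
  rw [h.activeProb_eq hB hp hq]
  have hlost : 0 ≤ p * (1 - q) * levelProb π B :=
    mul_nonneg (mul_nonneg hp.1.le (sub_nonneg.2 hq.2)) (levelProb_nonneg π B)
  linarith

lemma activeProb_nonneg (hB : 1 ≤ B) (hp : p ∈ Set.Ioc 0 1) (hq : q ∈ Set.Icc 0 1) :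
    0 ≤ activeProb B p q := by
  obtain ⟨π, h⟩ := exists_isStationaryLaw hB hp hq
  rw [activeProb, h.availProb_eq hB hp hq]
  exact mul_nonneg hq.1 measureReal_nonneg

lemma activeProb_zero (B : ℕ) (p : ℝ) : activeProb B p 0 = 0 := zero_mul _

lemma activeProb_one (hB : 1 ≤ B) (hp : p ∈ Set.Ioc 0 1) : activeProb B p 1 = p := by
  obtain ⟨π, h⟩ := exists_isStationaryLaw hB hp ⟨zero_le_one, le_rfl⟩
  rw [h.activeProb_eq hB hp ⟨zero_le_one, le_rfl⟩, sub_self, mul_zero, zero_mul, sub_zero]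

lemma continuousOn_activeProb (hB : 1 ≤ B) (hp : p ∈ Set.Ioc 0 1) :
    ContinuousOn (activeProb B p) (Set.Icc 0 1) := by
  suffices h : ContinuousOn (fun q : ℝ =>
      q * (1 - (q * (1 - p)) ^ B / ∑ k ∈ range (B + 1), queueWeight B p q k)) (Set.Icc 0 1) from
    h.congr fun q hq => by rw [activeProb, availProb_eq_one_sub_div hB hp hq]
  rcases hp.2.eq_or_lt with rfl | hp1
  · simpa [Nat.one_le_iff_ne_zero.1 hB] using continuousOn_id' (Set.Icc (0 : ℝ) 1)
  · have hweight (k : ℕ) : Continuous fun q => queueWeight B p q k := by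
      unfold queueWeight birthDeathWeight upProb
      refine .mul (continuous_finsetProd _ fun j _ => ?_) (by fun_prop)
      split_ifs <;> fun_prop
    exact continuousOn_id.mul (continuousOn_const.sub (ContinuousOn.div (by fun_prop)
      (by fun_prop) fun q hq => (sum_queueWeight_pos B ⟨hp.1, hp1⟩ hq).ne'))

end EnergyQueue

section LaplaceTransform

open Filter
open scoped Topology ENNReal

/-- `exp (-x)` for `x ∈ [0, ∞]`, the integrand of Laplace transforms of `[0, ∞]`-valued random
variables. -/
noncomputable def negExp (x : ℝ≥0∞) : ℝ≥0∞ := EReal.exp (-(x : EReal))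

@[simp] lemma negExp_zero : negExp 0 = 1 := by simp [negExp]

lemma negExp_ofReal {t : ℝ} (ht : 0 ≤ t) :
    negExp (ENNReal.ofReal t) = ENNReal.ofReal (Real.exp (-t)) := by
  rw [negExp, EReal.coe_ennreal_ofReal, max_eq_left ht, ← EReal.coe_neg, EReal.exp_coe]

lemma negExp_add (x y : ℝ≥0∞) : negExp (x + y) = negExp x * negExp y := by
  rw [negExp, negExp, negExp, ← EReal.exp_add, EReal.coe_ennreal_add, EReal.neg_add, sub_eq_add_neg]
  · exact Or.inl (EReal.coe_ennreal_ne_bot _)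
  · exact Or.inr (EReal.coe_ennreal_ne_bot _)

lemma negExp_sum {ι : Type*} (s : Finset ι) (f : ι → ℝ≥0∞) :
    negExp (∑ i ∈ s, f i) = ∏ i ∈ s, negExp (f i) := by
  classical
  induction s using Finset.induction_on with
  | empty => simp
  | insert a s ha ih => rw [Finset.sum_insert ha, Finset.prod_insert ha, negExp_add, ih]

lemma negExp_natCast_mul (n : ℕ) (x : ℝ≥0∞) : negExp (n * x) = negExp x ^ n := by
  simpa using negExp_sum (Finset.range n) fun _ => x

lemma continuous_negExp : Continuous negExp :=
  ENNReal.continuous_exp.comp (continuous_neg.comp continuous_coe_ennreal_ereal)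

@[fun_prop]
lemma measurable_negExp : Measurable negExp := continuous_negExp.measurable

lemma antitone_negExp : Antitone negExp := fun _ _ h =>
  EReal.exp_monotone (EReal.neg_le_neg_iff.2 (EReal.coe_ennreal_le_coe_ennreal_iff.2 h))

lemma negExp_le_one (x : ℝ≥0∞) : negExp x ≤ 1 := by
  simpa using antitone_negExp (zero_le (a := x))

lemma negExp_neg_log_toENNReal {z : ℝ≥0∞} (hz : z ≤ 1) :
    negExp (-ENNReal.log z).toENNReal = z := by
  rw [negExp, EReal.coe_toENNReal (EReal.neg_nonneg.2 (ENNReal.log_le_zero_iff.2 hz)), neg_neg,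
    ENNReal.exp_log]

variable {Ω E F : Type*} [MeasurableSpace Ω] [MeasurableSpace E] [MeasurableSpace F]
  {μ : Measure Ω}

lemma tendsto_lintegral_negExp [IsFiniteMeasure μ] {u : ℕ → Ω → ℝ≥0∞} {v : Ω → ℝ≥0∞}
    (hu : ∀ n, Measurable (u n)) (huv : ∀ ω, Tendsto (fun n => u n ω) atTop (𝓝 (v ω))) :
    Tendsto (fun n => ∫⁻ ω, negExp (u n ω) ∂μ) atTop (𝓝 (∫⁻ ω, negExp (v ω) ∂μ)) :=
  tendsto_lintegral_of_dominated_convergence (fun _ => 1) (fun n => measurable_negExp.comp (hu n))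
    (fun _ => ae_of_all _ fun _ => negExp_le_one _) (by simp)
    (ae_of_all _ fun ω => (continuous_negExp.tendsto _).comp (huv ω))

lemma lintegral_comp_prodMk_of_indepFun [IsProbabilityMeasure μ] {X : Ω → E} {Y : Ω → F}
    (hX : Measurable X) (hY : Measurable Y) (hXY : IndepFun X Y μ) {G : E × F → ℝ≥0∞}
    (hG : Measurable G) : ∫⁻ ω, G (X ω, Y ω) ∂μ = ∫⁻ ω, ∫⁻ ω', G (X ω, Y ω') ∂μ ∂μ := by
  have : IsProbabilityMeasure (μ.map Y) := Measure.isProbabilityMeasure_map hY.aemeasurable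
  rw [← lintegral_map hG (hX.prodMk hY),
    hXY.map_prod_eq_prod_map_map hX.aemeasurable hY.aemeasurable, lintegral_prod _ hG.aemeasurable,
    lintegral_map hG.lintegral_prod_right' hX]
  exact lintegral_congr fun ω => lintegral_map (hG.comp measurable_prodMk_left) hY

lemma lintegral_negExp_sum_of_iIndepFun {ι : Type*} {Z : ι → Ω → ℝ≥0∞}
    (hZ : ∀ i, Measurable (Z i)) (hind : iIndepFun Z μ) (s : Finset ι) :
    ∫⁻ ω, negExp (∑ i ∈ s, Z i ω) ∂μ = ∏ i ∈ s, ∫⁻ ω, negExp (Z i ω) ∂μ := by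
  simp_rw [negExp_sum]
  exact lintegral_prod_eq_prod_lintegral_of_indepFun s (fun i ω => negExp (Z i ω))
    (hind.comp _ fun _ => measurable_negExp) fun i => measurable_negExp.comp (hZ i)

lemma lintegral_negExp_tsum_of_iIndepFun [IsFiniteMeasure μ] {Z : ℕ → Ω → ℝ≥0∞} {c : ℕ → ℝ≥0∞}
    (hZ : ∀ s, Measurable (Z s)) (hind : iIndepFun Z μ)
    (hc : ∀ s, ∫⁻ ω, negExp (Z s ω) ∂μ = negExp (c s)) :
    ∫⁻ ω, negExp (∑' s, Z s ω) ∂μ = negExp (∑' s, c s) := by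
  have hpartial (n : ℕ) : ∫⁻ ω, negExp (∑ s ∈ Finset.range n, Z s ω) ∂μ =
      negExp (∑ s ∈ Finset.range n, c s) := by
    simp_rw [lintegral_negExp_sum_of_iIndepFun hZ hind, hc, negExp_sum]
  refine tendsto_nhds_unique (tendsto_lintegral_negExp (fun n => by fun_prop)
    fun ω => ENNReal.summable.hasSum.tendsto_sum_nat) ?_
  simp_rw [hpartial]
  exact (continuous_negExp.tendsto _).comp ENNReal.summable.hasSum.tendsto_sum_nat

lemma lintegral_pow_poissonMeasure (r : NNReal) {z : ℝ≥0∞} (hz : z ≤ 1) :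
    ∫⁻ n, z ^ n ∂poissonMeasure r = negExp (r * (1 - z)) := by
  lift z to NNReal using ne_top_of_le_ne_top ENNReal.one_ne_top hz
  have hnonneg : 0 ≤ (r : ℝ) * (1 - z) :=
    mul_nonneg r.2 (sub_nonneg.2 (by exact_mod_cast hz))
  have hreal : (r : ℝ≥0∞) * (1 - z) = ENNReal.ofReal (r * (1 - z)) := by
    rw [ENNReal.ofReal_mul r.coe_nonneg, ENNReal.ofReal_sub _ z.coe_nonneg, ENNReal.ofReal_one,
      ENNReal.ofReal_coe_nnreal, ENNReal.ofReal_coe_nnreal]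
  have htilt (n : ℕ) : (z : ℝ≥0∞) ^ n * poissonMeasure r {n} =
      negExp (r * (1 - z)) * poissonMeasure (r * z) {n} := by
    rw [hreal, negExp_ofReal hnonneg, poissonMeasure_singleton, poissonMeasure_singleton,
      ← ENNReal.ofReal_coe_nnreal, ← ENNReal.ofReal_pow z.coe_nonneg,
      ← ENNReal.ofReal_mul (by positivity), ← ENNReal.ofReal_mul (by positivity)]
    congr 1
    have hexp : Real.exp (-r) = Real.exp (-(r * (1 - z))) * Real.exp (-(r * z)) := by
      rw [← Real.exp_add]
      ring_nf
    rw [hexp]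
    push_cast
    ring
  have hmass : ∑' n, poissonMeasure (r * z) {n} = 1 := by
    simpa using (lintegral_countable' (μ := poissonMeasure (r * z)) fun _ => 1).symm
  simp_rw [lintegral_countable', htilt, ENNReal.tsum_mul_left, hmass, mul_one]

end LaplaceTransform

section PoissonProcess

open Filter Set
open scoped Topology ENNReal

lemma exists_monotone_finMeasSupp_tendsto {α : Type*} [MeasurableSpace α] (μ : Measure α)
    [SigmaFinite μ] {φ : α → ℝ≥0∞} (hφ : Measurable φ) :
    ∃ f : ℕ → SimpleFunc α ℝ≥0∞, (∀ n, (f n).FinMeasSupp μ) ∧ (∀ x, Monotone fun n => f n x) ∧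
      ∀ x, Tendsto (fun n => f n x) atTop (𝓝 (φ x)) := by
  have hrestrict (n : ℕ) (x : α) : (SimpleFunc.eapprox φ n).restrict (spanningSets μ n) x =
      (spanningSets μ n).indicator (SimpleFunc.eapprox φ n) x :=
    SimpleFunc.restrict_apply _ (measurableSet_spanningSets μ n) x
  refine ⟨fun n => (SimpleFunc.eapprox φ n).restrict (spanningSets μ n), fun n => ?_,
    fun x m n hmn => ?_, fun x => ?_⟩
  · refine SimpleFunc.finMeasSupp_iff_support.2 ((measure_mono ?_).trans_lt
      (measure_spanningSets_lt_top μ n))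
    rw [funext (hrestrict n)]
    exact support_indicator_subset
  · simp only [hrestrict]
    exact (indicator_le_indicator (SimpleFunc.monotone_eapprox φ hmn x)).trans
      (indicator_le_indicator_of_subset (monotone_spanningSets μ hmn) (fun _ => zero_le) x)
  · refine (SimpleFunc.tendsto_eapprox hφ x).congr' ?_
    filter_upwards [eventually_mem_spanningSets μ x] with n hn
    rw [hrestrict, indicator_of_mem hn]

variable {Ω : Type*} {X : ℕ → Ω → Plane}

lemma toENNReal_pointCount (X : ℕ → Ω → Plane) (A : Set Plane) (ω : Ω) :
    (pointCount X A ω : ℝ≥0∞) = Measure.count ((fun s => X s ω) ⁻¹' A) :=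
  (Measure.count_apply .of_discrete).symm

lemma tsum_simpleFunc_comp (X : ℕ → Ω → Plane) (f : SimpleFunc Plane ℝ≥0∞) (ω : Ω) :
    ∑' s, f (X s ω) = ∑ y ∈ f.range, y * (pointCount X (f ⁻¹' {y}) ω : ℝ≥0∞) := by
  rw [← lintegral_count, ← lintegral_map f.measurable (.of_discrete),
    SimpleFunc.lintegral_eq_lintegral, SimpleFunc.lintegral]
  refine Finset.sum_congr rfl fun y _ => ?_
  rw [Measure.map_apply .of_discrete (f.measurableSet_fiber y), toENNReal_pointCount]

variable [MeasurableSpace Ω] {μ : Measure Ω} {lam : ℝ}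

lemma measurable_pointCount (hX : ∀ s, Measurable (X s)) {A : Set Plane}
    (hA : MeasurableSet A) : Measurable (pointCount X A) := by
  have hsum : (fun ω => (pointCount X A ω : ℝ≥0∞)) = fun ω => ∑' s, A.indicator 1 (X s ω) := by
    ext ω
    rw [toENNReal_pointCount, ← lintegral_indicator_one .of_discrete, lintegral_count]
    rfl
  have hmeas : Measurable fun ω => (pointCount X A ω : ℝ≥0∞) := by
    rw [hsum]
    exact .tsum fun s => (measurable_one.indicator hA).comp (hX s)
  refine ENat.measurable_iff.2 fun n => ?_
  convert hmeas (measurableSet_singleton ((n : ℕ∞) : ℝ≥0∞)) using 1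
  ext ω
  exact ENat.toENNReal_inj.symm

namespace IsPoissonProcess

lemma lintegral_negExp_mul_pointCount (h : IsPoissonProcess μ lam X) {A : Set Plane}
    (hA : MeasurableSet A) (hfin : volume A ≠ ∞) (c : ℝ≥0∞) :
    ∫⁻ ω, negExp (c * (pointCount X A ω : ℝ≥0∞)) ∂μ =
      negExp (ENNReal.ofReal lam * ((1 - negExp c) * volume A)) := by
  rw [← lintegral_map (f := fun n : ℕ∞ => negExp (c * (n : ℝ≥0∞))) .of_discrete
    (measurable_pointCount h.measurable hA), h.count_law A hA hfin,
    lintegral_map .of_discrete .of_discrete]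
  simp_rw [ENat.toENNReal_coe, mul_comm c, negExp_natCast_mul]
  rw [lintegral_pow_poissonMeasure _ (negExp_le_one c)]
  change negExp (ENNReal.ofReal (lam * (volume A).toReal) * _) = _
  rw [ENNReal.ofReal_mul' ENNReal.toReal_nonneg, ENNReal.ofReal_toReal hfin, mul_assoc,
    mul_comm (volume A)]

lemma iIndepFun_pointCount (h : IsPoissonProcess μ lam X) {ι : Type*} [Finite ι]
    {A : ι → Set Plane} (hA : ∀ i, MeasurableSet (A i)) (hfin : ∀ i, volume (A i) ≠ ∞)
    (hdisj : Pairwise fun i j => Disjoint (A i) (A j)) :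
    iIndepFun (fun i => pointCount X (A i)) μ := by
  obtain ⟨n, ⟨e⟩⟩ := Finite.exists_equiv_fin ι
  have hind := h.count_indep n (fun k => A (e.symm k)) (fun _ => hA _) (fun _ => hfin _)
    (hdisj.comp_of_injective e.symm.injective)
  simpa using hind.precomp e.injective

lemma lintegral_negExp_sum_pointCount (h : IsPoissonProcess μ lam X) {ι : Type*} [Fintype ι]
    {A : ι → Set Plane} (hA : ∀ i, MeasurableSet (A i)) (hfin : ∀ i, volume (A i) ≠ ∞)
    (hdisj : Pairwise fun i j => Disjoint (A i) (A j)) (c : ι → ℝ≥0∞) :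
    ∫⁻ ω, negExp (∑ i, c i * (pointCount X (A i) ω : ℝ≥0∞)) ∂μ =
      negExp (ENNReal.ofReal lam * ∑ i, (1 - negExp (c i)) * volume (A i)) := by
  rw [lintegral_negExp_sum_of_iIndepFun (Z := fun i ω => c i * (pointCount X (A i) ω : ℝ≥0∞))
    (fun i => (Measurable.of_discrete (f := fun n : ℕ∞ => c i * (n : ℝ≥0∞))).comp
      (measurable_pointCount h.measurable (hA i)))
    ((h.iIndepFun_pointCount hA hfin hdisj).comp (fun i n => c i * (n : ℝ≥0∞))
      fun _ => .of_discrete)]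
  simp_rw [h.lintegral_negExp_mul_pointCount (hA _) (hfin _), ← negExp_sum, Finset.mul_sum]

lemma lintegral_negExp_tsum_simpleFunc (h : IsPoissonProcess μ lam X)
    {f : SimpleFunc Plane ℝ≥0∞} (hf : f.FinMeasSupp volume) :
    ∫⁻ ω, negExp (∑' s, f (X s ω)) ∂μ =
      negExp (ENNReal.ofReal lam * ∫⁻ x, (1 - negExp (f x))) := by
  have hnonzero (a b : ℝ≥0∞ → ℝ≥0∞) (ha : a 0 = 0) : ∑ y ∈ f.range, a y * b y =
      ∑ y : {y // y ∈ f.range.erase 0}, a (y : ℝ≥0∞) * b (y : ℝ≥0∞) := by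
    rw [Finset.sum_coe_sort _ fun y => a y * b y, Finset.sum_erase _ (by rw [ha, zero_mul])]
  have hlevels : ∫⁻ x, (1 - negExp (f x)) =
      ∑ y ∈ f.range, (1 - negExp y) * volume (f ⁻¹' {y}) := by
    rw [← SimpleFunc.map_lintegral (fun y => 1 - negExp y), ← SimpleFunc.lintegral_eq_lintegral]
    rfl
  simp_rw [hlevels, tsum_simpleFunc_comp]
  rw [hnonzero (fun y => 1 - negExp y) _ (by simp)]
  simp_rw [hnonzero (fun y => y) _ rfl]
  exact h.lintegral_negExp_sum_pointCount
    (A := fun y : {y // y ∈ f.range.erase 0} => f ⁻¹' {(y : ℝ≥0∞)})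
    (fun y => f.measurableSet_fiber y)
    (fun y => (SimpleFunc.finMeasSupp_iff.1 hf y (Finset.ne_of_mem_erase y.2)).ne)
    (fun y z hyz => Disjoint.preimage f (disjoint_singleton.2 (Subtype.coe_injective.ne hyz))) _

theorem lintegral_negExp_tsum [IsFiniteMeasure μ] (h : IsPoissonProcess μ lam X)
    {φ : Plane → ℝ≥0∞} (hφ : Measurable φ) :
    ∫⁻ ω, negExp (∑' s, φ (X s ω)) ∂μ =
      negExp (ENNReal.ofReal lam * ∫⁻ x, (1 - negExp (φ x))) := by
  obtain ⟨f, hfin, hmono, hlim⟩ := exists_monotone_finMeasSupp_tendsto volume hφ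
  have hsum (ω : Ω) : Tendsto (fun n => ∑' s, f n (X s ω)) atTop (𝓝 (∑' s, φ (X s ω))) := by
    simp_rw [← lintegral_count]
    exact lintegral_tendsto_of_tendsto_of_monotone (fun n => by fun_prop)
      (ae_of_all _ fun s => hmono _) (ae_of_all _ fun s => hlim _)
  have hintensity : Tendsto (fun n => ∫⁻ x, (1 - negExp (f n x))) atTop
      (𝓝 (∫⁻ x, (1 - negExp (φ x)))) :=
    lintegral_tendsto_of_tendsto_of_monotone (fun n => by fun_prop)
      (ae_of_all _ fun x m n hmn => tsub_le_tsub_left (antitone_negExp (hmono x hmn)) 1)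
      (ae_of_all _ fun x => ENNReal.Tendsto.sub tendsto_const_nhds
        ((continuous_negExp.tendsto _).comp (hlim x)) (Or.inl ENNReal.one_ne_top))
  have hlaplace := tendsto_lintegral_negExp (μ := μ)
    (fun n => .tsum fun s => (f n).measurable.comp (h.measurable s)) hsum
  simp_rw [Function.comp_apply, h.lintegral_negExp_tsum_simpleFunc (hfin _)] at hlaplace
  exact tendsto_nhds_unique hlaplace <| (continuous_negExp.tendsto _).comp
    (ENNReal.Tendsto.const_mul hintensity (Or.inr ENNReal.ofReal_ne_top))

-- The marks are averaged out first: given the points, they turn `g` into the function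
-- `φ x = -log (∫⁻ y, exp (-g (x, y)) ∂ρ)` of the points alone.
theorem lintegral_negExp_tsum_marked [IsProbabilityMeasure μ] (h : IsPoissonProcess μ lam X)
    {E : Type*} [MeasurableSpace E] {Y : ℕ → Ω → E} {ρ : Measure E} [IsProbabilityMeasure ρ]
    (hY : ∀ s, Measurable (Y s)) (hYρ : ∀ s, μ.map (Y s) = ρ) (hind : iIndepFun Y μ)
    (hXY : IndepFun (fun ω s => X s ω) (fun ω s => Y s ω) μ) {g : Plane × E → ℝ≥0∞}
    (hg : Measurable g) :
    ∫⁻ ω, negExp (∑' s, g (X s ω, Y s ω)) ∂μ =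
      negExp (ENNReal.ofReal lam * ∫⁻ x, ∫⁻ y, (1 - negExp (g (x, y))) ∂ρ) := by
  set φ : Plane → ℝ≥0∞ := fun x => (-ENNReal.log (∫⁻ y, negExp (g (x, y)) ∂ρ)).toENNReal
  have hmeas : Measurable fun z : Plane × E => negExp (g z) := measurable_negExp.comp hg
  have hφ : Measurable φ := (hmeas.lintegral_prod_right'.ennreal_log.neg).ereal_toENNReal
  have hφg (x : Plane) : ∫⁻ y, negExp (g (x, y)) ∂ρ = negExp (φ x) :=
    (negExp_neg_log_toENNReal ((lintegral_mono fun y => negExp_le_one _).trans (by simp))).symm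
  have hcompl (x : Plane) : ∫⁻ y, (1 - negExp (g (x, y))) ∂ρ = 1 - negExp (φ x) := by
    rw [lintegral_sub (by fun_prop) ?_ (ae_of_all _ fun y => negExp_le_one _), lintegral_one,
      measure_univ, hφg]
    exact hφg x ▸ ne_top_of_le_ne_top ENNReal.one_ne_top (negExp_le_one _)
  simp_rw [hcompl, ← h.lintegral_negExp_tsum hφ]
  rw [lintegral_comp_prodMk_of_indepFun (measurable_pi_lambda _ h.measurable)
    (measurable_pi_lambda _ hY) hXY
    (G := fun z : (ℕ → Plane) × (ℕ → E) => negExp (∑' s, g (z.1 s, z.2 s)))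
    (measurable_negExp.comp (.tsum fun s => by fun_prop))]
  refine lintegral_congr fun ω => lintegral_negExp_tsum_of_iIndepFun (fun s => by fun_prop)
    (hind.comp (fun s y => g (X s ω, y)) fun s => by fun_prop) fun s => ?_
  rw [← hφg, ← hYρ s, lintegral_map (by fun_prop) (hY s)]

end IsPoissonProcess

end PoissonProcess

section ExponentialLaw

open scoped ENNReal

lemma measurable_exponentialPDF (r : ℝ) : Measurable (exponentialPDF r) :=
  (measurable_exponentialPDFReal r).ennreal_ofReal

lemma lintegral_expMeasure (r : ℝ) {f : ℝ → ℝ≥0∞} (hf : Measurable f) :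
    ∫⁻ x, f x ∂expMeasure r = ∫⁻ x, exponentialPDF r x * f x :=
  lintegral_withDensity_eq_lintegral_mul _ (measurable_exponentialPDF r) hf

variable {r s : ℝ}

lemma exponentialPDF_mul_negExp (hr : 0 < r) (hs : 0 ≤ s) (x : ℝ) :
    exponentialPDF r x * negExp (ENNReal.ofReal s * ENNReal.ofReal x) =
      ENNReal.ofReal (r / (r + s)) * exponentialPDF (r + s) x := by
  rcases lt_or_ge x 0 with hx | hx
  · rw [exponentialPDF_of_neg hx, exponentialPDF_of_neg hx, zero_mul, mul_zero]
  · have hexp : Real.exp (-((r + s) * x)) = Real.exp (-(r * x)) * Real.exp (-(s * x)) := by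
      rw [← Real.exp_add]
      ring_nf
    rw [exponentialPDF_of_nonneg hx, exponentialPDF_of_nonneg hx,
      ← ENNReal.ofReal_mul hs, negExp_ofReal (by positivity),
      ← ENNReal.ofReal_mul (by positivity), ← ENNReal.ofReal_mul (by positivity), hexp]
    congr 1
    field_simp

lemma lintegral_negExp_expMeasure (hr : 0 < r) (hs : 0 ≤ s) :
    ∫⁻ x, negExp (ENNReal.ofReal s * ENNReal.ofReal x) ∂expMeasure r =
      ENNReal.ofReal (r / (r + s)) := by
  rw [lintegral_expMeasure _ (by fun_prop)]
  simp_rw [exponentialPDF_mul_negExp hr hs]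
  rw [lintegral_const_mul _ (measurable_exponentialPDF _),
    lintegral_exponentialPDF_eq_one (by positivity), mul_one]

lemma lintegral_one_sub_negExp_expMeasure (hr : 0 < r) (hs : 0 ≤ s) :
    ∫⁻ x, (1 - negExp (ENNReal.ofReal s * ENNReal.ofReal x)) ∂expMeasure r =
      ENNReal.ofReal (s / (r + s)) := by
  have := isProbabilityMeasure_expMeasure hr
  have hlaplace := lintegral_negExp_expMeasure hr hs
  rw [lintegral_sub (by fun_prop) (hlaplace ▸ ENNReal.ofReal_ne_top)
    (ae_of_all _ fun _ => negExp_le_one _), hlaplace, lintegral_one, measure_univ,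
    ← ENNReal.ofReal_one, ← ENNReal.ofReal_sub _ (by positivity)]
  congr 1
  field_simp
  ring

lemma expMeasure_lt_ofReal_mul {a : ℝ} (hr : 0 < r) (ha : 0 < a) (y : ℝ≥0∞) :
    expMeasure r {x | y < ENNReal.ofReal (a * x)} = negExp (ENNReal.ofReal (r / a) * y) := by
  have := isProbabilityMeasure_expMeasure hr
  induction y with
  | top => simp [ENNReal.mul_top, hr, ha, negExp]
  | coe y =>
    have htail : {x : ℝ | (y : ℝ≥0∞) < ENNReal.ofReal (a * x)} = (Set.Iic (y / a : ℝ))ᶜ := by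
      ext x
      simp only [Set.mem_ofPred_eq, Set.mem_compl_iff, Set.mem_Iic, not_le]
      rw [← ENNReal.ofReal_coe_nnreal, ENNReal.ofReal_lt_ofReal_iff_of_nonneg y.coe_nonneg,
        div_lt_iff₀' ha]
    rw [htail, ← ofReal_measureReal, probReal_compl_eq_one_sub measurableSet_Iic, ← cdf_eq_real,
      cdf_expMeasure_eq hr, if_pos (by positivity), sub_sub_cancel, ← ENNReal.ofReal_coe_nnreal,
      ← ENNReal.ofReal_mul (by positivity), negExp_ofReal (by positivity), mul_div_left_comm,
      mul_comm (y : ℝ)]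

lemma ae_pos_expMeasure (hr : 0 < r) : ∀ᵐ x ∂expMeasure r, 0 < x := by
  have := isProbabilityMeasure_expMeasure hr
  have hpos := expMeasure_lt_ofReal_mul hr one_pos 0
  simp only [one_mul, ENNReal.ofReal_pos, mul_zero, negExp_zero] at hpos
  exact (mem_ae_iff_prob_eq_one measurableSet_Ioi).2 hpos

lemma lintegral_rpow_expMeasure_one {a : ℝ} (ha : -1 < a) :
    ∫⁻ x, ENNReal.ofReal (x ^ a) ∂expMeasure 1 = ENNReal.ofReal (Real.Gamma (a + 1)) := by
  have hΓ : 0 < Real.Gamma (a + 1) := Real.Gamma_pos_of_pos (by linarith)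
  have hpdf : ∀ᵐ x : ℝ, exponentialPDF 1 x * ENNReal.ofReal (x ^ a) =
      ENNReal.ofReal (Real.Gamma (a + 1)) * gammaPDF (a + 1) 1 x := by
    have hne : ∀ᵐ x : ℝ, x ≠ 0 := by simp [ae_iff]
    filter_upwards [hne] with x hne
    rcases lt_or_gt_of_ne hne with hx | hx
    · rw [exponentialPDF_of_neg hx, gammaPDF_of_neg hx, zero_mul, mul_zero]
    · rw [exponentialPDF_of_nonneg hx.le, gammaPDF_of_nonneg hx.le,
        ← ENNReal.ofReal_mul (by positivity), ← ENNReal.ofReal_mul hΓ.le, Real.one_rpow,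
        add_sub_cancel_right]
      congr 1
      field_simp
  rw [lintegral_expMeasure _ (by fun_prop), lintegral_congr_ae hpdf,
    lintegral_const_mul (f := gammaPDF (a + 1) 1) _
      (measurable_gammaPDFReal _ _).ennreal_ofReal,
    lintegral_gammaPDF_eq_one (by linarith) one_pos, mul_one]

end ExponentialLaw

section PlanarIntegral

variable {α : ℝ}

lemma pi_mul_Gamma_mul_Gamma_eq_kappa (hα : α ≠ 0) :
    Real.pi * Real.Gamma (2 / α + 1) * Real.Gamma (1 - 2 / α) = kappa α := by
  have hreflection := Real.Gamma_mul_Gamma_one_sub (2 / α)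
  calc Real.pi * Real.Gamma (2 / α + 1) * Real.Gamma (1 - 2 / α)
      = Real.pi * (2 / α) * (Real.Gamma (2 / α) * Real.Gamma (1 - 2 / α)) := by
        rw [Real.Gamma_add_one (by positivity)]
        ring
    _ = kappa α := by
        rw [hreflection, kappa, show Real.pi * (2 / α) = 2 * Real.pi / α by ring]
        field_simp

lemma lintegral_plane_exp_neg_mul_rpow {b : ℝ} (hα : 1 ≤ α) (hb : 0 < b) :
    ∫⁻ x : Plane, ENNReal.ofReal (Real.exp (-(b * ‖x‖ ^ α))) =
      ENNReal.ofReal (Real.pi * b ^ (-2 / α) * Real.Gamma (2 / α + 1)) := by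
  have hcomplex := Complex.integral_exp_neg_mul_rpow hα hb
  have hpos : 0 < Real.pi * b ^ (-2 / α) * Real.Gamma (2 / α + 1) := by positivity
  simp_rw [neg_mul] at hcomplex
  rw [← Complex.orthonormalBasisOneI.measurePreserving_repr.lintegral_comp (by fun_prop)]
  simp_rw [LinearIsometryEquiv.norm_map]
  rw [← hcomplex, ofReal_integral_eq_lintegral_ofReal
    (.of_integral_ne_zero (hcomplex ▸ hpos.ne')) (ae_of_all _ fun x => (Real.exp_pos _).le)]

lemma lintegral_plane_negExp_rpow_mul {s g : ℝ} (hα : 1 ≤ α) (hs : 0 < s) (hg : 0 < g) :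
    ∫⁻ x : Plane, negExp (ENNReal.ofReal (‖x‖ ^ α / s) * ENNReal.ofReal g) =
      ENNReal.ofReal (Real.pi * s ^ (2 / α) * Real.Gamma (2 / α + 1)) *
        ENNReal.ofReal (g ^ (-(2 / α))) := by
  have hexp (x : Plane) : negExp (ENNReal.ofReal (‖x‖ ^ α / s) * ENNReal.ofReal g) =
      ENNReal.ofReal (Real.exp (-(g / s * ‖x‖ ^ α))) := by
    rw [← ENNReal.ofReal_mul (by positivity), negExp_ofReal (by positivity), mul_comm,
      mul_div_left_comm, mul_comm (‖x‖ ^ α)]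
  simp_rw [hexp]
  rw [lintegral_plane_exp_neg_mul_rpow hα (by positivity), ← ENNReal.ofReal_mul (by positivity),
    neg_div, Real.rpow_neg (by positivity), Real.div_rpow hg.le hs.le, Real.rpow_neg hg.le]
  congr 1
  field_simp

-- The integrand is the Laplace transform of the exponential law of rate one, so that exchanging
-- the integrals leaves the planar integral of `exp (-c ‖x‖ ^ α)`.
lemma lintegral_plane_one_div_one_add_rpow {s : ℝ} (hα : 2 < α) (hs : 0 < s) :
    ∫⁻ x : Plane, ENNReal.ofReal (1 / (1 + ‖x‖ ^ α / s)) =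
      ENNReal.ofReal (s ^ (2 / α) * kappa α) := by
  have := isProbabilityMeasure_expMeasure one_pos
  have hα0 : 0 < α := two_pos.trans hα
  have hexponent : -1 < -(2 / α) := neg_lt_neg ((div_lt_one hα0).2 hα)
  calc ∫⁻ x : Plane, ENNReal.ofReal (1 / (1 + ‖x‖ ^ α / s))
      = ∫⁻ x : Plane, ∫⁻ g, negExp (ENNReal.ofReal (‖x‖ ^ α / s) * ENNReal.ofReal g)
          ∂expMeasure 1 :=
        lintegral_congr fun x => (lintegral_negExp_expMeasure one_pos (by positivity)).symm
    _ = ∫⁻ g, (∫⁻ x : Plane, negExp (ENNReal.ofReal (‖x‖ ^ α / s) * ENNReal.ofReal g))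
          ∂expMeasure 1 :=
        lintegral_lintegral_swap (Measurable.aemeasurable (by unfold Function.uncurry; fun_prop))
    _ = ∫⁻ g, ENNReal.ofReal (Real.pi * s ^ (2 / α) * Real.Gamma (2 / α + 1)) *
          ENNReal.ofReal (g ^ (-(2 / α))) ∂expMeasure 1 := by
        refine lintegral_congr_ae ?_
        filter_upwards [ae_pos_expMeasure one_pos] with g hg
        exact lintegral_plane_negExp_rpow_mul (by linarith) hs hg
    _ = ENNReal.ofReal (s ^ (2 / α) * kappa α) := by
        rw [lintegral_const_mul _ (by fun_prop), lintegral_rpow_expMeasure_one hexponent,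
          ← ENNReal.ofReal_mul (by positivity), ← pi_mul_Gamma_mul_Gamma_eq_kappa hα0.ne']
        ring_nf

lemma kappa_pos (hα : 2 < α) : 0 < kappa α := by
  have hα0 : 0 < α := two_pos.trans hα
  have hsin : 0 < Real.sin (2 * Real.pi / α) := by
    refine Real.sin_pos_of_pos_of_lt_pi (by positivity) ?_
    rw [div_lt_iff₀' hα0]
    exact mul_lt_mul_of_pos_right hα Real.pi_pos
  rw [kappa]
  positivity

lemma lamMax_pos {d θ : ℝ} (hα : 2 < α) (hd : 0 < d) (hθ : 0 < θ) : 0 < lamMax α d θ := by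
  have := kappa_pos hα
  rw [lamMax]
  positivity

end PlanarIntegral

section ReceivedPower

open scoped ENNReal

lemma isProbabilityMeasure_coinLaw {q : ℝ} (hq : q ∈ Set.Icc 0 1) :
    IsProbabilityMeasure (coinLaw q) := by
  refine ⟨?_⟩
  simp only [coinLaw, Measure.add_apply, Measure.smul_apply, measure_univ, smul_eq_mul, mul_one]
  rw [← ENNReal.ofReal_add hq.1 (sub_nonneg.2 hq.2), add_sub_cancel, ENNReal.ofReal_one]

lemma coinLaw_singleton_true (q : ℝ) : coinLaw q {true} = ENNReal.ofReal q := by simp [coinLaw]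

lemma lintegral_prod_indicator_one_mul {E F : Type*} [MeasurableSpace E] [MeasurableSpace F]
    {μ : Measure E} {ν : Measure F} [SFinite ν] {A : Set E} (hA : MeasurableSet A)
    {f : F → ℝ≥0∞} (hf : Measurable f) :
    ∫⁻ z, A.indicator 1 z.1 * f z.2 ∂μ.prod ν = μ A * ∫⁻ y, f y ∂ν := by
  rw [lintegral_prod_mul (measurable_one.indicator hA).aemeasurable hf.aemeasurable,
    lintegral_indicator_one hA]

/-- The power that the origin receives from a transmitter at `z.1` whose battery level, coin and
power gain are `z.2`: the interference is the sum of these powers. -/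
noncomputable def receivedPower (B : ℕ) (α : ℝ) (z : Plane × Fin (B + 1) × Bool × ℝ) : ℝ≥0∞ :=
  if z.2.1 ≠ 0 ∧ z.2.2.1 = true then ‖z.1‖ₑ ^ (-α) * ENNReal.ofReal z.2.2.2 else 0

@[fun_prop]
lemma measurable_receivedPower (B : ℕ) (α : ℝ) : Measurable (receivedPower B α) := by
  have hstate : Measurable fun z : Plane × Fin (B + 1) × Bool × ℝ => (z.2.1, z.2.2.1) := by
    fun_prop
  have htransmits : MeasurableSet {w : Fin (B + 1) × Bool | w.1 ≠ 0 ∧ w.2 = true} := .of_discrete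
  exact .ite (hstate htransmits) (by fun_prop) measurable_const

variable {B : ℕ} {α t : ℝ} {x : Plane}

lemma one_sub_negExp_receivedPower (ht : 0 ≤ t) (hx : x ≠ 0) (y : Fin (B + 1) × Bool × ℝ) :
    1 - negExp (ENNReal.ofReal t * receivedPower B α (x, y)) =
      ({0}ᶜ : Set (Fin (B + 1))).indicator 1 y.1 * (({true} : Set Bool).indicator 1 y.2.1 *
        (1 - negExp (ENNReal.ofReal (t * ‖x‖ ^ (-α)) * ENNReal.ofReal y.2.2))) := by
  obtain ⟨e, c, g⟩ := y
  have hpathLoss : ENNReal.ofReal (t * ‖x‖ ^ (-α)) = ENNReal.ofReal t * ‖x‖ₑ ^ (-α) := by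
    rw [ENNReal.ofReal_mul ht, ← ofReal_norm, ENNReal.ofReal_rpow_of_pos (norm_pos_iff.2 hx)]
  by_cases he : e = 0
  · simp [receivedPower, he]
  · cases c <;> simp [receivedPower, he, hpathLoss, mul_assoc]

lemma lintegral_one_sub_negExp_receivedPower {q ν : ℝ} (hq : q ∈ Set.Icc 0 1) (hν : 0 < ν)
    (ht : 0 < t) (π : Measure (Fin (B + 1))) [IsFiniteMeasure π] (hx : x ≠ 0) :
    ∫⁻ y, (1 - negExp (ENNReal.ofReal t * receivedPower B α (x, y)))
        ∂π.prod ((coinLaw q).prod (expMeasure ν)) =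
      ENNReal.ofReal (q * π.real {0}ᶜ) * ENNReal.ofReal (1 / (1 + ‖x‖ ^ α / (t / ν))) := by
  have := isProbabilityMeasure_expMeasure hν
  have := isProbabilityMeasure_coinLaw hq
  have hnorm : 0 < ‖x‖ := norm_pos_iff.2 hx
  have hgain : t * ‖x‖ ^ (-α) / (ν + t * ‖x‖ ^ (-α)) = 1 / (1 + ‖x‖ ^ α / (t / ν)) := by
    rw [Real.rpow_neg hnorm.le]
    field_simp
    ring
  simp_rw [one_sub_negExp_receivedPower ht.le hx]
  rw [lintegral_prod_indicator_one_mul (f := fun y : Bool × ℝ => ({true} : Set Bool).indicator 1 y.1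
      * (1 - negExp (ENNReal.ofReal (t * ‖x‖ ^ (-α)) * ENNReal.ofReal y.2))) .of_discrete
    (((measurable_one.indicator (.of_discrete)).comp measurable_fst).mul (by fun_prop)),
    lintegral_prod_indicator_one_mul (f := fun g =>
      1 - negExp (ENNReal.ofReal (t * ‖x‖ ^ (-α)) * ENNReal.ofReal g)) .of_discrete (by fun_prop),
    lintegral_one_sub_negExp_expMeasure hν (by positivity), coinLaw_singleton_true, hgain,
    ENNReal.ofReal_mul hq.1, ofReal_measureReal, ← mul_assoc, mul_comm (π _)]

end ReceivedPower

namespace Network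

open scoped ENNReal

variable {B : ℕ} {p q lam ν α d θ : ℝ}

attribute [local instance] Network.mΩ Network.prob

/-- The marks of interfering transmitter `s`, nested as in `Network.marks_law`. -/
def mark (N : Network.{u} B p q lam ν) (s : ℕ) (ω : N.Ω) : Fin (B + 1) × Bool × ℝ :=
  (N.energy s ω, N.coin s ω, N.gain s ω)

lemma measurable_mark (N : Network.{u} B p q lam ν) (s : ℕ) : Measurable (N.mark s) :=
  (N.measurable_energy s).prodMk ((N.measurable_coin s).prodMk (N.measurable_gain s))

lemma interference_eq_tsum (N : Network.{u} B p q lam ν) (α : ℝ) :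
    N.interference α = fun ω => ∑' s, receivedPower B α (N.pos s ω, N.mark s ω) := by
  ext ω
  refine tsum_congr fun s => ?_
  simp only [receivedPower, mark, Transmits]
  congr

lemma measurable_interference (N : Network.{u} B p q lam ν) (α : ℝ) :
    Measurable (N.interference α) := by
  rw [interference_eq_tsum]
  exact .tsum fun s =>
    (measurable_receivedPower B α).comp ((N.poisson.measurable s).prodMk (N.measurable_mark s))

lemma indepFun_ownGain_interference (N : Network.{u} B p q lam ν) (α : ℝ) :
    IndepFun N.ownGain (N.interference α) N.μ := by
  rw [interference_eq_tsum]
  exact N.ownGain_indep.comp (ψ := fun z : (ℕ → Plane) × (ℕ → Fin (B + 1) × Bool × ℝ) =>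
    ∑' s, receivedPower B α (z.1 s, z.2 s)) measurable_id
    (.tsum fun s => (measurable_receivedPower B α).comp (by fun_prop))

lemma lintegral_negExp_interference (N : Network.{u} B p q lam ν) (hB : 1 ≤ B)
    (hp : p ∈ Set.Ioc 0 1) (hq : q ∈ Set.Icc 0 1) (hlam : 0 ≤ lam) (hν : 0 < ν) (hα : 2 < α)
    {t : ℝ} (ht : 0 < t) :
    ∫⁻ ω, negExp (ENNReal.ofReal t * N.interference α ω) ∂N.μ =
      ENNReal.ofReal
        (Real.exp (-(lam * (activeProb B p q * ((t / ν) ^ (2 / α) * kappa α))))) := by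
  have := N.stationary.1
  have := isProbabilityMeasure_expMeasure hν
  have := isProbabilityMeasure_coinLaw hq
  have hκ := kappa_pos hα
  have hactive := activeProb_nonneg hB hp hq
  have hmarks : ∀ᵐ x : Plane, ∫⁻ y, (1 - negExp (ENNReal.ofReal t * receivedPower B α (x, y)))
      ∂N.energyLaw.prod ((coinLaw q).prod (expMeasure ν)) =
      ENNReal.ofReal (activeProb B p q) * ENNReal.ofReal (1 / (1 + ‖x‖ ^ α / (t / ν))) := by
    have hne : ∀ᵐ x : Plane, x ≠ 0 := by simp [ae_iff]
    filter_upwards [hne] with x hx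
    rw [lintegral_one_sub_negExp_receivedPower hq hν ht _ hx,
      activeProb, N.stationary.availProb_eq hB hp hq]
  simp_rw [interference_eq_tsum, ← ENNReal.tsum_mul_left]
  rw [N.poisson.lintegral_negExp_tsum_marked (g := fun z => ENNReal.ofReal t * receivedPower B α z)
      N.measurable_mark N.marks_law N.marks_indep N.pos_indep_marks (by fun_prop),
    lintegral_congr_ae hmarks, lintegral_const_mul _ (by fun_prop),
    lintegral_plane_one_div_one_add_rpow hα (by positivity), ← ENNReal.ofReal_mul hactive,
    ← ENNReal.ofReal_mul hlam, negExp_ofReal (by positivity)]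

lemma lt_SIR_iff (N : Network.{u} B p q lam ν) (hθ : 0 < θ) (ω : N.Ω) :
    ENNReal.ofReal θ < N.SIR α d ω ↔
      ENNReal.ofReal θ * N.interference α ω < ENNReal.ofReal (d ^ (-α) * N.ownGain ω) := by
  rw [SIR]
  by_cases hsignal : ENNReal.ofReal (d ^ (-α) * N.ownGain ω) = 0
  · simp [hsignal]
  by_cases hinterference : N.interference α ω = ∞
  · simp [hinterference, ENNReal.mul_top, hθ, ENNReal.div_top]
  exact ENNReal.lt_div_iff_mul_lt (Or.inr ENNReal.ofReal_ne_top) (Or.inl hinterference)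

-- Rayleigh fading: the signal power has an exponential tail, so that averaging over it turns the
-- success probability into a Laplace transform of the interference.
lemma measure_lt_SIR (N : Network.{u} B p q lam ν) (hν : 0 < ν) (hd : 0 < d) (hθ : 0 < θ) :
    N.μ {ω | ENNReal.ofReal θ < N.SIR α d ω} =
      ∫⁻ ω, negExp (ENNReal.ofReal (ν * (θ * d ^ α)) * N.interference α ω) ∂N.μ := by
  let success : Set (ℝ≥0∞ × ℝ) :=
    {z | ENNReal.ofReal θ * z.1 < ENNReal.ofReal (d ^ (-α) * z.2)}
  have := isProbabilityMeasure_expMeasure hν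
  have hmeas : MeasurableSet success := measurableSet_lt (by fun_prop) (by fun_prop)
  have hI := N.measurable_interference α
  have hpreimage : {ω | ENNReal.ofReal θ < N.SIR α d ω} =
      (fun ω => (N.interference α ω, N.ownGain ω)) ⁻¹' success :=
    Set.ext fun ω => N.lt_SIR_iff hθ ω
  have htail (y : ℝ≥0∞) : expMeasure ν (Prod.mk y ⁻¹' success) =
      negExp (ENNReal.ofReal (ν * (θ * d ^ α)) * y) := by
    refine (expMeasure_lt_ofReal_mul hν (Real.rpow_pos_of_pos hd (-α))
      (ENNReal.ofReal θ * y)).trans ?_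
    rw [← mul_assoc, ← ENNReal.ofReal_mul (by positivity), Real.rpow_neg hd.le, div_inv_eq_mul,
      mul_assoc, mul_comm θ]
  rw [hpreimage, ← Measure.map_apply (hI.prodMk N.measurable_ownGain) hmeas,
    (N.indepFun_ownGain_interference α).symm.map_prod_eq_prod_map_map hI.aemeasurable
      N.measurable_ownGain.aemeasurable, N.ownGain_law, Measure.prod_apply hmeas]
  simp_rw [htail]
  exact lintegral_map (by fun_prop) hI

theorem successProb_eq (N : Network.{u} B p q lam ν) (hB : 1 ≤ B) (hp : p ∈ Set.Ioc 0 1)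
    (hq : q ∈ Set.Icc 0 1) (hlam : 0 ≤ lam) (hν : 0 < ν) (hα : 2 < α) (hd : 0 < d) (hθ : 0 < θ) :
    N.successProb α d θ = Real.exp (-(activeProb B p q * lam / lamMax α d θ)) := by
  have hpower : (θ * d ^ α) ^ (2 / α) = d ^ 2 * θ ^ (2 / α) := by
    rw [Real.mul_rpow hθ.le (by positivity), ← Real.rpow_mul hd.le,
      mul_div_cancel₀ _ (by linarith : α ≠ 0), Real.rpow_two, mul_comm]
  rw [successProb, measureReal_def, N.measure_lt_SIR hν hd hθ,
    N.lintegral_negExp_interference hB hp hq hlam hν hα (by positivity),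
    ENNReal.toReal_ofReal (Real.exp_pos _).le, mul_div_cancel_left₀ _ hν.ne', hpower, lamMax]
  congr 2
  field_simp

end Network

section PriceOfAnarchy

lemma isPriceOfAnarchy_div {S : Type*} {TH : S → S → ℝ} {C : S → ℝ} {best worst : S}
    (hbest : ∀ q, C q ≤ C best) (hSNE : IsSNE TH worst) (hworst : ∀ q, IsSNE TH q → C worst ≤ C q)
    (hpos : 0 < C worst) : IsPriceOfAnarchy TH C (C best / C worst) :=
  ⟨C best, C worst, ⟨⟨best, rfl⟩, Set.forall_mem_range.2 hbest⟩,
    ⟨⟨worst, hSNE, rfl⟩, Set.forall_mem_image.2 hworst⟩, hpos, rfl⟩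

lemma mul_exp_neg_div_le_of_le {m x y : ℝ} (hxy : x ≤ y) (hy : 0 < y) (hym : y ≤ m) :
    x * Real.exp (-(x / m)) ≤ y * Real.exp (-(y / m)) := by
  have hratio : x / y ≤ Real.exp (-((y - x) / m)) := by
    calc x / y = -((y - x) / y) + 1 := by field_simp; ring
      _ ≤ -((y - x) / m) + 1 := by gcongr
      _ ≤ Real.exp (-((y - x) / m)) := Real.add_one_le_exp _
  calc x * Real.exp (-(x / m)) ≤ Real.exp (-((y - x) / m)) * y * Real.exp (-(x / m)) := by
        gcongr
        exact (div_le_iff₀ hy).1 hratio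
    _ = y * Real.exp (-((y - x) / m) + -(x / m)) := by rw [Real.exp_add]; ring
    _ = y * Real.exp (-(y / m)) := by ring_nf

lemma mul_exp_neg_div_le {m : ℝ} (hm : 0 < m) (x : ℝ) :
    x * Real.exp (-(x / m)) ≤ m * Real.exp (-(m / m)) := by
  have hscaled := mul_le_mul_of_nonneg_left (Real.mul_exp_neg_le_exp_neg_one (x / m)) hm.le
  rwa [← mul_assoc, mul_div_cancel₀ _ hm.ne', ← div_self hm.ne'] at hscaled

variable {B : ℕ} {p lam ν α d θ : ℝ}

lemma exists_activeProb_eq (hB : 1 ≤ B) (hp : p ∈ Set.Ioc 0 1) {c : ℝ} (hc : c ∈ Set.Icc 0 p) :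
    ∃ y ∈ Set.Icc 0 1, activeProb B p y = c := by
  refine intermediate_value_Icc zero_le_one (continuousOn_activeProb hB hp) ?_
  rwa [activeProb_zero, activeProb_one hB hp]

lemma capacity_eq (hB : 1 ≤ B) (hp : p ∈ Set.Ioc 0 1) (hlam : 0 ≤ lam) (hν : 0 < ν) (hα : 2 < α)
    (hd : 0 < d) (hθ : 0 < θ) (net : ∀ q : Access, Network.{u} B p q lam ν) (q : Access) :
    capacity net α d θ q = activeProb B p q * lam *
      Real.exp (-(activeProb B p q * lam / lamMax α d θ)) * Real.logb 2 (1 + θ) := by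
  rw [capacity, throughput, (net q).successProb_eq hB hp q.2 hlam hν hα hd hθ]
  ring

lemma throughput_le_throughput_iff (hB : 1 ≤ B) (hp : p ∈ Set.Ioc 0 1) (hlam : 0 ≤ lam)
    (hν : 0 < ν) (hα : 2 < α) (hd : 0 < d) (hθ : 0 < θ)
    (net : ∀ q : Access, Network.{u} B p q lam ν) (q₁ q₂ q : Access) :
    throughput net α d θ q₁ q ≤ throughput net α d θ q₂ q ↔
      activeProb B p q₁ ≤ activeProb B p q₂ := by
  rw [throughput, throughput, (net q).successProb_eq hB hp q.2 hlam hν hα hd hθ,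
    mul_le_mul_iff_left₀ (Real.logb_pos one_lt_two (by linarith)),
    mul_le_mul_iff_left₀ (Real.exp_pos _)]

lemma isSNE_throughput_iff (hB : 1 ≤ B) (hp : p ∈ Set.Ioc 0 1) (hlam : 0 ≤ lam) (hν : 0 < ν)
    (hα : 2 < α) (hd : 0 < d) (hθ : 0 < θ) (net : ∀ q : Access, Network.{u} B p q lam ν)
    (q : Access) : IsSNE (throughput net α d θ) q ↔ activeProb B p q = p := by
  simp only [IsSNE, throughput_le_throughput_iff hB hp hlam hν hα hd hθ]
  refine ⟨fun hq => (activeProb_le hB hp q.2).antisymm ?_, fun hq q' => ?_⟩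
  · simpa only [Set.Icc.coe_one, activeProb_one hB hp] using hq 1
  · rw [hq]
    exact activeProb_le hB hp q'.2

lemma isPriceOfAnarchy_of_forall_capacity_le (hB : 1 ≤ B) (hp : p ∈ Set.Ioc 0 1) (hlam : 0 < lam)
    (hν : 0 < ν) (hα : 2 < α) (hd : 0 < d) (hθ : 0 < θ)
    {net : ∀ q : Access, Network.{u} B p q lam ν} {qs : Access}
    (hqs : ∀ q, capacity net α d θ q ≤ capacity net α d θ qs) :
    IsPriceOfAnarchy (throughput net α d θ) (capacity net α d θ)
      (lam * activeProb B p qs * Real.exp (-(activeProb B p qs * lam / lamMax α d θ)) /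
        (lam * p * Real.exp (-(p * lam / lamMax α d θ)))) := by
  have hrate : 0 < Real.logb 2 (1 + θ) := Real.logb_pos one_lt_two (by linarith)
  have hcapacity := capacity_eq hB hp hlam.le hν hα hd hθ net
  have hSNE := isSNE_throughput_iff hB hp hlam.le hν hα hd hθ net
  have hone : activeProb B p (1 : Access) = p := activeProb_one hB hp
  have hp0 : 0 < p := hp.1
  have hPoA := isPriceOfAnarchy_div hqs ((hSNE 1).2 hone)
    (fun q hq => by rw [hcapacity, hcapacity, hone, (hSNE q).1 hq])
    (by rw [hcapacity, hone]; positivity)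
  rw [hcapacity, hcapacity, hone, mul_div_mul_right _ _ hrate.ne'] at hPoA
  rwa [mul_comm lam (activeProb B p qs), mul_comm lam p]

lemma capacity_le_capacity_one (hB : 1 ≤ B) (hp : p ∈ Set.Ioc 0 1) (hlam : 0 < lam) (hν : 0 < ν)
    (hα : 2 < α) (hd : 0 < d) (hθ : 0 < θ) (hle : p ≤ lamMax α d θ / lam)
    (net : ∀ q : Access, Network.{u} B p q lam ν) (q : Access) :
    capacity net α d θ q ≤ capacity net α d θ 1 := by
  have hrate : 0 < Real.logb 2 (1 + θ) := Real.logb_pos one_lt_two (by linarith)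
  rw [capacity_eq hB hp hlam.le hν hα hd hθ, capacity_eq hB hp hlam.le hν hα hd hθ,
    Set.Icc.coe_one, activeProb_one hB hp, mul_le_mul_iff_left₀ hrate]
  exact mul_exp_neg_div_le_of_le (mul_le_mul_of_nonneg_right (activeProb_le hB hp q.2) hlam.le)
    (mul_pos hp.1 hlam) ((le_div_iff₀ hlam).1 hle)

lemma capacity_le_capacity_of_activeProb_eq (hB : 1 ≤ B) (hp : p ∈ Set.Ioc 0 1) (hlam : 0 < lam)
    (hν : 0 < ν) (hα : 2 < α) (hd : 0 < d) (hθ : 0 < θ)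
    (net : ∀ q : Access, Network.{u} B p q lam ν) {qs : Access}
    (hqs : activeProb B p qs = lamMax α d θ / lam) (q : Access) :
    capacity net α d θ q ≤ capacity net α d θ qs := by
  have hrate : 0 < Real.logb 2 (1 + θ) := Real.logb_pos one_lt_two (by linarith)
  rw [capacity_eq hB hp hlam.le hν hα hd hθ, capacity_eq hB hp hlam.le hν hα hd hθ, hqs,
    div_mul_cancel₀ _ hlam.ne', mul_le_mul_iff_left₀ hrate]
  exact mul_exp_neg_div_le (lamMax_pos hα hd hθ) _

end PriceOfAnarchy

theorem lemma3 {B : ℕ} (hB : 1 ≤ B) {p lam ν α d θ : ℝ} (hp : 0 < p) (hp1 : p ≤ 1)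
    (hlam : 0 < lam) (hν : 0 < ν) (hα : 2 < α) (hd : 0 < d) (hθ : 0 < θ)
    (net : ∀ q : Access, Network.{u} B p q lam ν) :
    ((∀ y ∈ Set.Icc (0 : ℝ) 1, activeProb B p y ≠ lamMax α d θ / lam) →
      IsPriceOfAnarchy (throughput net α d θ) (capacity net α d θ) 1) ∧
    (∀ qs : Access, activeProb B p qs = lamMax α d θ / lam →
      (∀ q, capacity net α d θ q ≤ capacity net α d θ qs) ∧
      IsPriceOfAnarchy (throughput net α d θ) (capacity net α d θ)
        (lam * activeProb B p qs * Real.exp (-(activeProb B p qs * lam / lamMax α d θ)) /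
          (lam * p * Real.exp (-(p * lam / lamMax α d θ))))) := by
  have hp' : p ∈ Set.Ioc 0 1 := ⟨hp, hp1⟩
  refine ⟨fun hno => ?_, fun qs hqs => ?_⟩
  · have hle : p ≤ lamMax α d θ / lam := by
      by_contra! hlt
      obtain ⟨y, hy, hsol⟩ :=
        exists_activeProb_eq hB hp' ⟨(div_pos (lamMax_pos hα hd hθ) hlam).le, hlt.le⟩
      exact hno y hy hsol
    have hPoA := isPriceOfAnarchy_of_forall_capacity_le hB hp' hlam hν hα hd hθ
      (capacity_le_capacity_one hB hp' hlam hν hα hd hθ hle net)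
    rwa [Set.Icc.coe_one, activeProb_one hB hp', div_self (by positivity)] at hPoA
  · have hmax := capacity_le_capacity_of_activeProb_eq hB hp' hlam hν hα hd hθ net hqs
    exact ⟨hmax, isPriceOfAnarchy_of_forall_capacity_le hB hp' hlam hν hα hd hθ hmax⟩
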